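/- Let $C$ be a countable (possibly finite) group and let $n \ge 2$ be an integer. Then there exist a countable torsion-free group $H$ and a normal subgroup $M \lhd H$ such that (i) $M$ has exactly $n$ conjugacy classes of elements (property ($n$CC), the class of the identity being counted); (ii) $M$ is $2$-boundedly simple, i.e., for all $x, y \in M \setminus \{1\}$ there exist $l \le 2$ and $g_1, \dots, g_l \in M$ such that $x = g_1 y g_1^{-1} \cdots g_l y g_l^{-1}$; (iii) the action of $H$ on $M$ by conjugation preserves the conjugacy classes of $M$, i.e., for all $h \in H$ and $a \in M$ there exists $b \in M$ such that $h a h^{-1} = b a b^{-1}$; (iv) $H/M \cong C$. -/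

import Mathlib

universe u

/-- A group is torsion-free if its identity is its only element of finite order. -/
def IsTorsionFreeGroup (G : Type*) [Group G] : Prop :=
  ∀ g : G, g ≠ 1 → ¬ IsOfFinOrder g

/-- `G` has `(nCC)`: it has exactly `n` conjugacy classes of elements. -/
def HasNCC (G : Type*) [Group G] (n : ℕ) : Prop :=
  ENat.card (ConjClasses G) = n

/-- `G` is `k`-boundedly simple: for all non-trivial `x`, `y` there are `l ≤ k` and
`g₁, …, gₗ` in `G` such that `x = (g₁ * y * g₁⁻¹) * ⋯ * (gₗ * y * gₗ⁻¹)`. -/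
def IsBoundedlySimple (k : ℕ) (G : Type*) [Group G] : Prop :=
  ∀ x y : G, x ≠ 1 → y ≠ 1 →
    ∃ gs : List G, gs.length ≤ k ∧ x = (gs.map fun g => g * y * g⁻¹).prod

/-- The conjugation action of `H` on its subgroup `M` preserves the conjugacy classes of `M`. -/
def ConjPreservesClasses {H : Type*} [Group H] (M : Subgroup H) : Prop :=
  ∀ h : H, ∀ a ∈ M, ∃ b ∈ M, h * a * h⁻¹ = b * a * b⁻¹

/-! Take `M` to be the kernel of a surjection `H → C`, and label the elements of `H` by `n - 1`
colours, invariant under conjugation and non-zero powers. It suffices that non-trivial elements of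
`M` with equal colours are conjugate in `M`: the classes of `M` are then `{1}` and one per colour,
and conjugation by `H` keeps colours, hence classes. Such an `H` is a union of HNN extensions of a
free group, with stable letters mapped to `1` in `C`. `exists_conj` makes `x` and `y` conjugate;
Collins' lemma (`apply_eq_of_conj_of_eq_of`) prevents different colours from merging.
`exists_eq_conj_mul_conj` gives 2-bounded simplicity, and `exists_complete` iterates over all pairs.
-/

namespace HNNExtension

/-! ### Reduced words, Collins' lemma and torsion in HNN extensions -/

open NormalWord

variable {G : Type*} [Group G] {A B : Subgroup G} (φ : A ≃* B)

/-- The product of the syllables `t ^ u * g` of a list of pairs `(u, g)`. -/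
def syllableProd (l : List (ℤˣ × G)) : HNNExtension G A B φ :=
  (l.map fun x => t ^ (x.1 : ℤ) * of x.2).prod

variable (A B) in
/-- The list of syllables `t ^ u * g` has no subword `t ^ u * g * t ^ (-u)` which can be
rewritten as an element of the base group. -/
def IsReducedList (l : List (ℤˣ × G)) : Prop :=
  l.IsChain fun a b => a.2 ∈ toSubgroup A B a.1 → a.1 = b.1

@[simp]
theorem syllableProd_nil : syllableProd φ ([] : List (ℤˣ × G)) = 1 := rfl

@[simp]
theorem syllableProd_cons (x : ℤˣ × G) (l : List (ℤˣ × G)) :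
    syllableProd φ (x :: l) = t ^ (x.1 : ℤ) * of x.2 * syllableProd φ l := by
  simp [syllableProd]

@[simp]
theorem syllableProd_append (l₁ l₂ : List (ℤˣ × G)) :
    syllableProd φ (l₁ ++ l₂) = syllableProd φ l₁ * syllableProd φ l₂ := by
  simp [syllableProd]

theorem exists_eq_of_mul_syllableProd (g : HNNExtension G A B φ) :
    ∃ (h : G) (l : List (ℤˣ × G)), IsReducedList A B l ∧ g = of h * syllableProd φ l := by
  obtain ⟨d⟩ := TransversalPair.nonempty G A B
  refine ⟨(equiv φ d g).head, (equiv φ d g).toList, (equiv φ d g).chain, ?_⟩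
  exact ((equiv φ d).symm_apply_apply g).symm

theorem eq_nil_of_syllableProd_eq_of {l : List (ℤˣ × G)} (hl : IsReducedList A B l) {g : G}
    (h : syllableProd φ l = of g) : l = [] :=
  ReducedWord.toList_eq_nil_of_mem_of_range φ ⟨1, l, hl⟩
    ⟨g, by simpa [ReducedWord.prod, syllableProd] using h.symm⟩

theorem t_zpow_mul_of (u : ℤˣ) (a : toSubgroup A B u) :
    (t : HNNExtension G A B φ) ^ (u : ℤ) * of (a : G) =
      of (toSubgroupEquiv φ u a : G) * t ^ (u : ℤ) := by
  rcases Int.units_eq_one_or u with rfl | rfl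
  · rw [Units.val_one, zpow_one]
    exact t_mul_of (φ := φ) a
  · rw [Units.val_neg, Units.val_one, zpow_neg, zpow_one]
    exact inv_t_mul_of (φ := φ) a

/-- Reducedness never tests the group entry of the last syllable, so that entry can absorb `v`. -/
theorem IsReducedList.exists_mul_of {l : List (ℤˣ × G)} (hl : IsReducedList A B l) (hn : l ≠ [])
    (v : G) : ∃ l' : List (ℤˣ × G), IsReducedList A B l' ∧ l'.map Prod.fst = l.map Prod.fst ∧
      syllableProd φ l' = syllableProd φ l * of v := by
  induction l with
  | nil => exact absurd rfl hn
  | cons x l ih =>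
    obtain ⟨u, a⟩ := x
    rcases l with _ | ⟨y, l⟩
    · exact ⟨[(u, a * v)], List.isChain_singleton _, rfl, by simp [mul_assoc]⟩
    · obtain ⟨l', h₁, h₂, h₃⟩ := ih (List.isChain_cons_cons.1 hl).2 (by simp)
      rcases l' with _ | ⟨z, l'⟩
      · simp at h₂
      · refine ⟨(u, a) :: z :: l', List.isChain_cons_cons.2 ⟨?_, h₁⟩, ?_, ?_⟩
        · have hz : z.1 = y.1 := by simpa using (List.cons_eq_cons.1 h₂).1
          rw [hz]
          exact (List.isChain_cons_cons.1 hl).1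
        · rw [List.map_cons, h₂]
          rfl
        · rw [syllableProd_cons, h₃, syllableProd_cons φ (u, a), mul_assoc _ _ (of v)]

/-- A class function on the base group that is compatible with the isomorphism of the
associated subgroups takes the same value on elements of the base group that are conjugate in the
HNN extension (a form of Collins' lemma). -/
theorem apply_eq_of_conj_of_eq_of {K : Type*} (c : G → K) (hconj : ∀ g p, c (p * g * p⁻¹) = c g)
    (hφ : ∀ a : A, c (φ a) = c a) {u v : G} (p : HNNExtension G A B φ)
    (h : p * of u * p⁻¹ = of v) : c u = c v := by
  have hu (e : ℤˣ) (a : toSubgroup A B e) : c (toSubgroupEquiv φ e a) = c a := by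
    rcases Int.units_eq_one_or e with rfl | rfl
    · exact hφ a
    · have := hφ (φ.symm a)
      erw [φ.apply_symm_apply] at this
      exact this.symm
  suffices H : ∀ (l : List (ℤˣ × G)), IsReducedList A B l → ∀ (g u v : G),
      of u * (of g * syllableProd φ l) = of g * syllableProd φ l * of v → c u = c v by
    obtain ⟨g, l, hl, hp⟩ := exists_eq_of_mul_syllableProd φ p⁻¹
    refine H l hl g u v ?_
    rw [← hp, ← h]
    group
  intro l
  induction l with
  | nil =>
    intro _ g u v h
    have h' : u * g = g * v := of_injective (φ := φ) (by simpa using h)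
    rw [← hconj v g, ← h', mul_inv_cancel_right]
  | cons x l ih =>
    obtain ⟨e, a⟩ := x
    intro hl g u v h
    have hl' : IsReducedList A B l := List.IsChain.tail hl
    have key : of (g⁻¹ * u * g) * syllableProd φ ((e, a) :: l) =
        syllableProd φ ((e, a) :: l) * of v := by
      rw [map_mul, map_mul, map_inv, mul_assoc, mul_assoc, h]
      group
    -- Once `v` is absorbed, both sides of `key` are reduced words, so their heads differ by an
    -- element of the associated subgroup. The first stable letter can then be cancelled.
    have hmem : g⁻¹ * u * g ∈ toSubgroup A B (-e) := by
      obtain ⟨l', h₁, h₂, h₃⟩ := hl.exists_mul_of φ (by simp) v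
      have := (ReducedWord.map_fst_eq_and_of_prod_eq φ (w₁ := ⟨g⁻¹ * u * g, (e, a) :: l, hl⟩)
        (w₂ := ⟨1, l', h₁⟩) (by
          simpa [ReducedWord.prod, syllableProd] using key.trans h₃.symm)).2 e (by simp)
      simpa [mul_assoc] using inv_mem this
    have hc : c (g⁻¹ * u * g) = c u := by simpa using hconj u g⁻¹
    rw [← hc, ← hu _ ⟨_, hmem⟩]
    apply ih hl' a
    have ht := t_zpow_mul_of φ (-e) ⟨_, hmem⟩
    rw [Units.val_neg, zpow_neg, inv_mul_eq_iff_eq_mul, ← mul_assoc, eq_mul_inv_iff_mul_eq] at ht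
    rw [syllableProd_cons] at key
    simp only at key ht
    rw [mul_assoc (t ^ _), ← mul_assoc (of (_ * _)), ht] at key
    simpa [mul_assoc] using key

theorem syllableProd_replicate_flatten (l : List (ℤˣ × G)) (k : ℕ) :
    syllableProd φ (List.replicate k l).flatten = syllableProd φ l ^ k := by
  induction k with
  | zero => simp
  | succ k ih => rw [List.replicate_succ, List.flatten_cons, syllableProd_append, ih, pow_succ']

theorem IsReducedList.replicate_flatten {x : ℤˣ × G} {l : List (ℤˣ × G)}
    (hl : IsReducedList A B (x :: l))
    (hcyc : ∀ y ∈ (x :: l).getLast?, y.2 ∈ toSubgroup A B y.1 → y.1 = x.1) (k : ℕ) :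
    IsReducedList A B (List.replicate k (x :: l)).flatten := by
  induction k with
  | zero => exact List.isChain_nil
  | succ k ih =>
    rw [List.replicate_succ, List.flatten_cons]
    refine List.isChain_append.2 ⟨hl, ih, fun y hy z hz => ?_⟩
    rcases k with _ | k
    · simp at hz
    · obtain rfl : x = z := by simpa [List.replicate_succ] using hz
      exact hcyc y hy

/-- Powers of a cyclically reduced word stay reduced, so are non-trivial by Britton's lemma.
Otherwise a conjugation removes two stable letters, and induction on length applies. -/
theorem eq_one_of_pow_eq_one (hG : ∀ (g : G) (k : ℕ), k ≠ 0 → g ^ k = 1 → g = 1)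
    (g : HNNExtension G A B φ) (k : ℕ) (hk : k ≠ 0) (hg : g ^ k = 1) : g = 1 := by
  suffices H : ∀ (n : ℕ) (l : List (ℤˣ × G)), l.length = n → IsReducedList A B l → ∀ h : G,
      (of h * syllableProd φ l) ^ k = 1 → of h * syllableProd φ l = 1 by
    obtain ⟨h, l, hl, rfl⟩ := exists_eq_of_mul_syllableProd φ g
    exact H _ l rfl hl h hg
  intro n
  induction n using Nat.strong_induction_on with
  | _ n ih =>
  intro l hn hl h hpow
  by_cases hnil : l = []
  · subst hnil
    have : h ^ k = 1 := of_injective (φ := φ) (by simpa using hpow)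
    simp [hG h k hk this]
  obtain ⟨l', hl', hfst, hprod⟩ := hl.exists_mul_of φ hnil h
  have hlen : l'.length = l.length := by simpa using congrArg List.length hfst
  have hconj : of h * syllableProd φ l = of h * syllableProd φ l' * (of h)⁻¹ := by
    rw [hprod]; group
  rw [hconj, conj_pow, conj_eq_one_iff] at hpow
  rw [hconj, conj_eq_one_iff]
  clear hconj hprod hl h
  rcases l' with _ | ⟨x, l₁⟩
  · exact absurd (List.length_eq_zero_iff.1 hlen.symm) hnil
  by_cases hcyc : ∀ y ∈ (x :: l₁).getLast?, y.2 ∈ toSubgroup A B y.1 → y.1 = x.1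
  · have hrep := hl'.replicate_flatten hcyc k
    rw [← syllableProd_replicate_flatten, ← map_one of] at hpow
    have := eq_nil_of_syllableProd_eq_of φ hrep hpow
    simp [hk] at this
  · push Not at hcyc
    obtain ⟨y, hy, hmem, hne⟩ := hcyc
    rcases l₁.eq_nil_or_concat' with rfl | ⟨l₂, z, rfl⟩
    · simp_all
    obtain rfl : z = y := by simpa [List.getLast?_cons] using hy
    obtain ⟨e, b⟩ := x
    obtain ⟨e', a⟩ := z
    obtain rfl : e = -e' := by
      rcases Int.units_eq_one_or e with rfl | rfl <;>
      rcases Int.units_eq_one_or e' with rfl | rfl <;> simp_all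
    have hl₂ : IsReducedList A B l₂ := by
      have := List.IsChain.tail hl'
      exact (List.isChain_append.1 this).1
    have ht := t_zpow_mul_of φ e' ⟨a, hmem⟩
    have hconj : syllableProd φ ((-e', b) :: (l₂ ++ [(e', a)])) =
        (t ^ (e' : ℤ) * of a)⁻¹ *
          (of (toSubgroupEquiv φ e' ⟨a, hmem⟩ * b) * syllableProd φ l₂) *
            (t ^ (e' : ℤ) * of a)⁻¹⁻¹ := by
      rw [map_mul, ← mul_inv_eq_iff_eq_mul.2 ht]
      simp
      group
    rw [hconj, conj_pow, conj_eq_one_iff] at hpow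
    rw [hconj, conj_eq_one_iff]
    refine ih l₂.length ?_ l₂ rfl hl₂ _ hpow
    simp at hlen
    omega

theorem countable [Countable G] : Countable (HNNExtension G A B φ) := by
  have : Function.Surjective fun x : G × List (ℤˣ × G) =>
      (of x.1 * syllableProd φ x.2 : HNNExtension G A B φ) := fun g => by
    obtain ⟨h, l, -, rfl⟩ := exists_eq_of_mul_syllableProd φ g
    exact ⟨(h, l), rfl⟩
  exact this.countable

end HNNExtension

-- Coloured groups and their HNN extensions

universe v w

/-- A countable torsion-free group over `C` whose elements are coloured by `K`, in such a way that
conjugates and non-trivial powers of an element have the colour of that element. -/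
structure ColoredGroup (C : Type v) [Group C] (K : Type w) where
  carrier : Type u
  [group : Group carrier]
  [countable : Countable carrier]
  eq_one_of_pow_eq_one : ∀ (g : carrier) (k : ℕ), k ≠ 0 → g ^ k = 1 → g = 1
  proj : carrier →* C
  color : carrier → K
  color_conj : ∀ g p, color (p * g * p⁻¹) = color g
  color_zpow : ∀ (g) (k : ℤ), k ≠ 0 → color (g ^ k) = color g

namespace ColoredGroup

variable {C : Type v} [Group C] {K : Type w}

instance : CoeSort (ColoredGroup.{u} C K) (Type u) := ⟨carrier⟩

instance (D : ColoredGroup.{u} C K) : Group D := D.group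

instance (D : ColoredGroup.{u} C K) : Countable D := D.countable

/-- Embeddings of coloured groups over `C`. -/
structure Emb (D E : ColoredGroup.{u} C K) where
  toHom : D →* E
  injective : Function.Injective toHom
  proj_apply : ∀ x, E.proj (toHom x) = D.proj x
  color_apply : ∀ x, E.color (toHom x) = D.color x

namespace Emb

variable {D E F : ColoredGroup.{u} C K}

/-- The identity embedding. -/
@[simps]
def refl (D : ColoredGroup.{u} C K) : Emb D D where
  toHom := MonoidHom.id D
  injective := fun _ _ h => h
  proj_apply _ := rfl
  color_apply _ := rfl

/-- Composition of embeddings. -/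
@[simps]
def trans (f : Emb D E) (g : Emb E F) : Emb D F where
  toHom := g.toHom.comp f.toHom
  injective := g.injective.comp f.injective
  proj_apply x := (g.proj_apply _).trans (f.proj_apply x)
  color_apply x := (g.color_apply _).trans (f.color_apply x)

end Emb

/-- A colouring of a group that is invariant under conjugation and taking powers extends to an
overgroup in which elements of different colours are not conjugate. -/
theorem exists_color_extension {H G : Type*} [Group H] [Group G] (ι : H →* G) (c : H → K)
    (hpow : ∀ (g) (k : ℤ), k ≠ 0 → c (g ^ k) = c g)
    (hconj : ∀ u v p, p * ι u * p⁻¹ = ι v → c u = c v) (d : K) :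
    ∃ c' : G → K, (∀ g p, c' (p * g * p⁻¹) = c' g) ∧ (∀ (g) (k : ℤ), k ≠ 0 → c' (g ^ k) = c' g) ∧
      (∀ u, c' (ι u) = c u) ∧
      ∀ g, (∀ k : ℤ, k ≠ 0 → ∀ u p, g ^ k ≠ p * ι u * p⁻¹) → c' g = d := by
  classical
  -- Invariance forces the colour of `g` to be that of `u`. Two candidates `u`, `v` agree because `g
  -- ^ (k * l)` is conjugate to powers of both.
  let R (g : G) (u : H) : Prop := ∃ k : ℤ, k ≠ 0 ∧ ∃ p, g ^ k = p * ι u * p⁻¹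
  have huniq (g u v) (hu : R g u) (hv : R g v) : c u = c v := by
    obtain ⟨k, hk, p, hp⟩ := hu
    obtain ⟨l, hl, q, hq⟩ := hv
    have h₁ : g ^ (k * l) = p * ι (u ^ l) * p⁻¹ := by rw [zpow_mul, hp, conj_zpow, map_zpow]
    have h₂ : g ^ (k * l) = q * ι (v ^ k) * q⁻¹ := by
      rw [mul_comm, zpow_mul, hq, conj_zpow, map_zpow]
    rw [← hpow u l hl, ← hpow v k hk]
    refine hconj _ _ (q⁻¹ * p) ?_
    calc _ = q⁻¹ * (p * ι (u ^ l) * p⁻¹) * q := by group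
      _ = _ := by rw [← h₁, h₂]; group
  let c' (g : G) : K := if h : ∃ u, R g u then c h.choose else d
  have hR {g u} (h : R g u) : c' g = c u := by
    have h' : ∃ u, R g u := ⟨u, h⟩
    simp only [c', dif_pos h']
    exact huniq g _ _ h'.choose_spec h
  have hd {g} (h : ¬ ∃ u, R g u) : c' g = d := dif_neg h
  have hRconj {g u} (p) (h : R g u) : R (p * g * p⁻¹) u := by
    obtain ⟨k, hk, q, hq⟩ := h
    exact ⟨k, hk, p * q, by rw [conj_zpow, hq]; group⟩
  refine ⟨c', fun g p => ?_, fun g k hk => ?_, fun u => hR ⟨1, one_ne_zero, 1, by simp⟩,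
    fun g hg => hd ?_⟩
  · by_cases h : ∃ u, R g u
    · obtain ⟨u, hu⟩ := h
      rw [hR hu, hR (hRconj p hu)]
    · rw [hd h, hd]
      rintro ⟨u, hu⟩
      have := hRconj p⁻¹ hu
      exact h ⟨u, by simpa [mul_assoc] using this⟩
  · by_cases h : ∃ u, R g u
    · obtain ⟨u, hu⟩ := h
      have hu' : R (g ^ k) (u ^ k) := by
        obtain ⟨l, hl, q, hq⟩ := hu
        exact ⟨l, hl, q, by rw [← zpow_mul, mul_comm, zpow_mul, hq, conj_zpow, map_zpow]⟩
      rw [hR hu, hR hu', hpow u k hk]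
    · rw [hd h, hd]
      rintro ⟨u, l, hl, q, hq⟩
      exact h ⟨u, k * l, mul_ne_zero hk hl, q, by rw [zpow_mul, hq]⟩
  · rintro ⟨u, k, hk, p, hp⟩
    exact hg k hk u p hp

/-- HNN extensions along colour-preserving isomorphisms of subgroups; the colour of the elements
without powers conjugate into the base group can be prescribed. -/
theorem exists_hnnExtension (D : ColoredGroup.{u} C K) (A B : Subgroup D) (φ : A ≃* B)
    (hproj : ∀ a : A, D.proj (φ a) = D.proj a) (hcolor : ∀ a : A, D.color (φ a) = D.color a)
    (d : K) :
    ∃ (E : ColoredGroup.{u} C K) (f : Emb D E) (t : E) (e : E →* Multiplicative ℤ),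
      E.proj t = 1 ∧ (∀ a : A, t * f.toHom a * t⁻¹ = f.toHom (φ a)) ∧
      e t = Multiplicative.ofAdd 1 ∧ (∀ x, e (f.toHom x) = 1) ∧
      ∀ g, e g ≠ 1 → E.color g = d := by
  obtain ⟨c, hc₁, hc₂, hc₃, hc₄⟩ := exists_color_extension
    (HNNExtension.of : D →* HNNExtension D A B φ) D.color D.color_zpow
    (fun u v p h => HNNExtension.apply_eq_of_conj_of_eq_of φ D.color D.color_conj hcolor p h) d
  have := HNNExtension.countable φ
  let e : HNNExtension D A B φ →* Multiplicative ℤ :=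
    HNNExtension.lift 1 (Multiplicative.ofAdd 1) (by simp)
  have hlift (a : A) : 1 * D.proj a = D.proj (φ a) * 1 := by rw [hproj, one_mul, mul_one]
  refine ⟨{ carrier := HNNExtension D A B φ
            eq_one_of_pow_eq_one := HNNExtension.eq_one_of_pow_eq_one φ D.eq_one_of_pow_eq_one
            proj := HNNExtension.lift D.proj 1 hlift
            color := c
            color_conj := hc₁
            color_zpow := hc₂ },
    { toHom := HNNExtension.of
      injective := HNNExtension.of_injective φ
      proj_apply := HNNExtension.lift_of _ _ hlift
      color_apply := hc₃ },
    HNNExtension.t, e, HNNExtension.lift_t _ _ hlift, fun a => (HNNExtension.equiv_eq_conj a).symm,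
    HNNExtension.lift_t _ _ _, HNNExtension.lift_of _ _ _, fun g hg => hc₄ g ?_⟩
  -- The exponent sum `e` of the stable letter vanishes on conjugates of the base group, but not on
  -- non-zero powers of `g`.
  intro k hk u p h
  have h' := congrArg e h
  rw [map_zpow, map_mul, map_mul, map_inv, HNNExtension.lift_of, MonoidHom.one_apply, mul_one,
    mul_inv_cancel] at h'
  apply hg
  have h'' := congrArg Multiplicative.toAdd h'
  rw [toAdd_zpow, toAdd_one, smul_eq_mul, mul_eq_zero] at h''
  exact Multiplicative.toAdd.injective (h''.resolve_left hk)

theorem exists_free_letter (D : ColoredGroup.{u} C K) (d : K) :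
    ∃ (E : ColoredGroup.{u} C K) (f : Emb D E) (t : E) (e : E →* Multiplicative ℤ),
      E.proj t = 1 ∧ e t = Multiplicative.ofAdd 1 ∧ (∀ x, e (f.toHom x) = 1) ∧
      ∀ g, e g ≠ 1 → E.color g = d := by
  obtain ⟨E, f, t, e, h₁, -, h⟩ := D.exists_hnnExtension ⊥ ⊥ (MulEquiv.refl _) (by simp) (by simp) d
  exact ⟨E, f, t, e, h₁, h⟩

theorem zpow_injective (D : ColoredGroup.{u} C K) {x : D} (hx : x ≠ 1) :
    Function.Injective (zpowersHom D x) := by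
  rw [injective_iff_map_eq_one]
  intro k hk
  rw [zpowersHom_apply] at hk
  by_contra hne
  have hk0 : k.toAdd ≠ 0 := fun h => hne (Multiplicative.toAdd.injective h)
  refine hx (D.eq_one_of_pow_eq_one x k.toAdd.natAbs (Int.natAbs_ne_zero.2 hk0) ?_)
  rcases Int.natAbs_eq k.toAdd with h | h <;> rw [h] at hk <;> simpa using hk

/-- Torsion-freeness makes both cyclic subgroups infinite, and power invariance makes `x ^ k ↦ y ^
k` colour-preserving. The prescribed colour `D.color 1` is arbitrary. -/
theorem exists_conj (D : ColoredGroup.{u} C K) {x y : D} (hx : x ≠ 1) (hy : y ≠ 1)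
    (hpx : D.proj x = 1) (hpy : D.proj y = 1) (hxy : D.color x = D.color y) :
    ∃ (E : ColoredGroup.{u} C K) (f : Emb D E) (t : E),
      E.proj t = 1 ∧ t * f.toHom x * t⁻¹ = f.toHom y := by
  let φ := (MonoidHom.ofInjective (D.zpow_injective hx)).symm.trans
    (MonoidHom.ofInjective (D.zpow_injective hy))
  have hφ (k : Multiplicative ℤ) : φ ⟨zpowersHom D x k, k, rfl⟩ = ⟨zpowersHom D y k, k, rfl⟩ := by
    have : (MonoidHom.ofInjective (D.zpow_injective hx)).symm ⟨zpowersHom D x k, k, rfl⟩ = k :=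
      (MulEquiv.symm_apply_eq _).2 rfl
    simp only [φ, MulEquiv.trans_apply, this]
    rfl
  obtain ⟨E, f, t, -, h₁, h₂, -⟩ := D.exists_hnnExtension _ _ φ
    (by
      rintro ⟨_, k, rfl⟩
      rw [hφ]
      simp [hpx, hpy])
    (by
      rintro ⟨_, k, rfl⟩
      rw [hφ]
      by_cases hk : k.toAdd = 0
      · simp [hk]
      · simp only [zpowersHom_apply]
        rw [D.color_zpow _ _ hk, D.color_zpow _ _ hk, hxy]) (D.color 1)
  refine ⟨E, f, t, h₁, ?_⟩
  have := h₂ ⟨zpowersHom D x (Multiplicative.ofAdd 1), _, rfl⟩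
  rw [hφ] at this
  simpa using this

/-- Any two elements `x`, `y ≠ 1` of the kernel of the projection become, in some
extension, such that `x` is the product of two conjugates of `y`. -/
theorem exists_eq_conj_mul_conj (D : ColoredGroup.{u} C K) {x y : D} (hy : y ≠ 1)
    (hpx : D.proj x = 1) (hpy : D.proj y = 1) :
    ∃ (E : ColoredGroup.{u} C K) (f : Emb D E) (a b : E), E.proj a = 1 ∧ E.proj b = 1 ∧
      f.toHom x = a * f.toHom y * a⁻¹ * (b * f.toHom y * b⁻¹) := by
  -- Write `x = s * (s⁻¹ * x)`: both factors have non-zero exponent sum in `s`, hence the colour of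
  -- `y`, and can be made conjugate to `y` in turn.
  obtain ⟨E, f, s, e, hs, he, hef, hd⟩ := D.exists_free_letter (D.color y)
  have hs₁ : e s ≠ 1 := by rw [he]; decide
  have hs₂ : e (s⁻¹ * f.toHom x) ≠ 1 := by rw [map_mul, map_inv, he, hef]; decide
  have hfy : f.toHom y ≠ 1 := fun h => hy (f.injective (h.trans (map_one _).symm))
  have hpfy : E.proj (f.toHom y) = 1 := (f.proj_apply y).trans hpy
  obtain ⟨E₁, f₁, a, ha, hay⟩ := E.exists_conj (y := s) hfy (fun h => hs₁ (by rw [h, map_one]))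
    hpfy hs (by rw [hd s hs₁, f.color_apply])
  have hne : f₁.toHom (f.toHom y) ≠ 1 := fun h => hfy (f₁.injective (h.trans (map_one _).symm))
  obtain ⟨E₂, f₂, b, hb, hby⟩ := E₁.exists_conj (y := f₁.toHom (s⁻¹ * f.toHom x)) hne
    (fun h => hs₂ (by rw [f₁.injective (h.trans (map_one _).symm), map_one]))
    ((f₁.proj_apply _).trans hpfy)
    (by rw [f₁.proj_apply, map_mul, map_inv, hs, f.proj_apply, hpx, inv_one, one_mul])
    (by rw [f₁.color_apply, f₁.color_apply, hd _ hs₂, f.color_apply])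
  refine ⟨E₂, (f.trans f₁).trans f₂, f₂.toHom a, b, (f₂.proj_apply a).trans ha, hb, ?_⟩
  have h₁ : f₂.toHom a * f₂.toHom (f₁.toHom (f.toHom y)) * (f₂.toHom a)⁻¹ =
      f₂.toHom (f₁.toHom s) := by rw [← map_inv, ← map_mul, ← map_mul, hay]
  simp only [Emb.trans_toHom, MonoidHom.comp_apply]
  rw [hby, h₁, ← map_mul, ← map_mul, mul_inv_cancel_left]

/-! ### Unions of chains and closure under solving pairs -/

section Chain

variable (D : ℕ → ColoredGroup.{u} C K) (f : ∀ i, Emb (D i) (D (i + 1)))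

/-- The composite embeddings in a chain of embeddings. -/
def chainEmb {i j : ℕ} (h : i ≤ j) : Emb (D i) (D j) :=
  Nat.leRecOn h (fun g => Emb.trans g (f _)) (Emb.refl (D i))

theorem chainEmb_self (i : ℕ) : chainEmb D f (le_refl i) = Emb.refl (D i) :=
  Nat.leRecOn_self _

theorem chainEmb_succ {i j : ℕ} (h : i ≤ j) :
    chainEmb D f (h.trans j.le_succ) = (chainEmb D f h).trans (f j) :=
  Nat.leRecOn_succ h _

theorem chainEmb_trans {i j k : ℕ} (hij : i ≤ j) (hjk : j ≤ k) (x : D i) :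
    (chainEmb D f hjk).toHom ((chainEmb D f hij).toHom x) =
      (chainEmb D f (hij.trans hjk)).toHom x := by
  induction k, hjk using Nat.le_induction with
  | base => rw [chainEmb_self]; rfl
  | succ k hjk ih =>
    rw [chainEmb_succ D f hjk, chainEmb_succ D f (hij.trans hjk)]
    exact congrArg (f k).toHom ih

/-- The union of a chain of embeddings of coloured groups. -/
theorem exists_union : ∃ (E : ColoredGroup.{u} C K) (ι : ∀ i, Emb (D i) E),
    (∀ i x, (ι (i + 1)).toHom ((f i).toHom x) = (ι i).toHom x) ∧
      ∀ e : E, ∃ i x, (ι i).toHom x = e := by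
  let F (i j : ℕ) (h : i ≤ j) : D i →* D j := (chainEmb D f h).toHom
  have : DirectedSystem (fun i => D i) (F · · ·) :=
    { map_self := fun i x => by simp only [F, chainEmb_self]; rfl
      map_map := fun k j i hij hjk x => chainEmb_trans D f hij hjk x }
  let L := DirectLimit (fun i => D i) F
  let proj : L →* C :=
    { toFun := DirectLimit.lift F (fun i => (D i).proj)
        fun i j h x => ((chainEmb D f h).proj_apply x).symm
      map_one' := DirectLimit.lift_one (fun i => (D i).proj) _
      map_mul' := DirectLimit.lift_mul (fun i => (D i).proj) _ }
  let color : L → K := DirectLimit.lift F (fun i => (D i).color)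
        fun i j h x => ((chainEmb D f h).color_apply x).symm
  let ι (i : ℕ) : D i →* L :=
    { toFun := fun x => ⟦⟨i, x⟩⟧
      map_one' := (DirectLimit.one_def i).symm
      map_mul' := fun x y => (DirectLimit.mul_def (G := fun i => D i) (f := F) i x y).symm }
  have hι (i : ℕ) : Function.Injective (ι i) :=
    DirectLimit.mk_injective F (fun i j h => (chainEmb D f h).injective) i
  have hsurj (e : L) : ∃ i x, ι i x = e := by
    obtain ⟨i, x, h⟩ := DirectLimit.exists_eq_mk F e
    exact ⟨i, x, h.symm⟩
  have hsurj₂ (e e' : L) : ∃ i x y, ι i x = e ∧ ι i y = e' := by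
    obtain ⟨i, x, y, h, h'⟩ := DirectLimit.exists_eq_mk₂ F e e'
    exact ⟨i, x, y, h.symm, h'.symm⟩
  have hcolor (i : ℕ) (x : D i) : color (ι i x) = (D i).color x := rfl
  let E : ColoredGroup.{u} C K :=
    { carrier := L
      countable := by
        have : Function.Surjective fun p : Σ i, D i => ι p.1 p.2 := fun e => by
          obtain ⟨i, x, h⟩ := hsurj e
          exact ⟨⟨i, x⟩, h⟩
        exact this.countable
      eq_one_of_pow_eq_one := fun g k hk h => by
        obtain ⟨i, x, rfl⟩ := hsurj g
        rw [← map_pow, ← map_one (ι i)] at h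
        rw [(D i).eq_one_of_pow_eq_one x k hk (hι i h), map_one]
      proj := proj
      color := color
      color_conj := fun g p => by
        obtain ⟨i, x, y, rfl, rfl⟩ := hsurj₂ g p
        rw [← map_inv, ← map_mul, ← map_mul, hcolor, hcolor, (D i).color_conj]
      color_zpow := fun g k hk => by
        obtain ⟨i, x, rfl⟩ := hsurj g
        rw [← map_zpow, hcolor, hcolor, (D i).color_zpow x k hk] }
  refine ⟨E, fun i => { toHom := ι i, injective := hι i, proj_apply := fun _ => rfl,
                        color_apply := hcolor i }, fun i x => ?_, hsurj⟩
  have h := DirectLimit.mk_apply i (i + 1) x (f := F) i.le_succ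
  have hF : F i (i + 1) i.le_succ = (f i).toHom := by
    simp only [F]
    rw [chainEmb_succ D f le_rfl, chainEmb_self]
    rfl
  rw [hF] at h
  exact h

end Chain

/-- If `x` and `y` are non-trivial elements of the kernel of the projection, then `x` is the product
of two conjugates of `y` in the kernel, and if they have the same colour they are conjugate in the
kernel. -/
def Solved (D : ColoredGroup.{u} C K) (x y : D) : Prop :=
  x ≠ 1 → y ≠ 1 → D.proj x = 1 → D.proj y = 1 →
    (D.color x = D.color y → ∃ t, D.proj t = 1 ∧ t * x * t⁻¹ = y) ∧
      ∃ a b, D.proj a = 1 ∧ D.proj b = 1 ∧ x = a * y * a⁻¹ * (b * y * b⁻¹)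

theorem Emb.ne_one {D E : ColoredGroup.{u} C K} (f : Emb D E) {x : D} (hx : x ≠ 1) :
    f.toHom x ≠ 1 :=
  fun h => hx (f.injective (h.trans (map_one _).symm))

theorem Solved.map {D E : ColoredGroup.{u} C K} (f : Emb D E) {x y : D} (h : D.Solved x y) :
    E.Solved (f.toHom x) (f.toHom y) := by
  intro hx hy hpx hpy
  rw [f.proj_apply] at hpx hpy
  obtain ⟨h₁, a, b, ha, hb, hab⟩ := h (fun h => hx (by rw [h, map_one]))
    (fun h => hy (by rw [h, map_one])) hpx hpy
  refine ⟨fun hc => ?_, f.toHom a, f.toHom b, (f.proj_apply a).trans ha,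
    (f.proj_apply b).trans hb, ?_⟩
  · rw [f.color_apply, f.color_apply] at hc
    obtain ⟨t, ht, htx⟩ := h₁ hc
    exact ⟨f.toHom t, (f.proj_apply t).trans ht, by rw [← htx]; simp⟩
  · rw [hab]
    simp

theorem exists_solved (D : ColoredGroup.{u} C K) (x y : D) :
    ∃ (E : ColoredGroup.{u} C K) (f : Emb D E), E.Solved (f.toHom x) (f.toHom y) := by
  by_cases h : x ≠ 1 ∧ y ≠ 1 ∧ D.proj x = 1 ∧ D.proj y = 1
  · obtain ⟨hx, hy, hpx, hpy⟩ := h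
    obtain ⟨E, f, a, b, ha, hb, hab⟩ := D.exists_eq_conj_mul_conj hy hpx hpy
    by_cases hc : D.color x = D.color y
    · obtain ⟨E', f', t, ht, htx⟩ := E.exists_conj (f.ne_one hx) (f.ne_one hy)
        ((f.proj_apply x).trans hpx) ((f.proj_apply y).trans hpy)
        (by rw [f.color_apply, f.color_apply, hc])
      refine ⟨E', f.trans f', fun _ _ _ _ => ⟨fun _ => ⟨t, ht, htx⟩, f'.toHom a, f'.toHom b,
        (f'.proj_apply a).trans ha, (f'.proj_apply b).trans hb, ?_⟩⟩
      simp [hab]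
    · refine ⟨E, f, fun _ _ _ _ => ⟨fun h => ?_, a, b, ha, hb, hab⟩⟩
      rw [f.color_apply, f.color_apply] at h
      exact absurd h hc
  · refine ⟨D, Emb.refl D, fun hx hy hpx hpy => absurd ⟨hx, hy, hpx, hpy⟩ h⟩

theorem exists_forall_solved (D : ColoredGroup.{u} C K) :
    ∃ (E : ColoredGroup.{u} C K) (f : Emb D E), ∀ x y, E.Solved (f.toHom x) (f.toHom y) := by
  obtain ⟨e, he⟩ := exists_surjective_nat (D × D)
  choose step stepEmb hstep using fun E : ColoredGroup.{u} C K => E.exists_solved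
  -- The embedding of `D` is carried along, so that stage `k` can treat the image of the `k`-th pair
  -- of `D`.
  let S : ℕ → Σ E : ColoredGroup.{u} C K, Emb D E := fun n =>
    Nat.rec ⟨D, Emb.refl D⟩ (fun k E => ⟨step E.1 (E.2.toHom (e k).1) (E.2.toHom (e k).2),
      E.2.trans (stepEmb E.1 _ _)⟩) n
  obtain ⟨E, ι, h₁, -⟩ := exists_union (fun i => (S i).1) (fun i => stepEmb (S i).1 _ _)
  have hι (i : ℕ) (x : D) : (ι i).toHom ((S i).2.toHom x) = (ι 0).toHom x := by
    induction i with
    | zero => rfl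
    | succ i ih =>
      rw [← ih, ← h₁ i]
      rfl
  refine ⟨E, ι 0, fun x y => ?_⟩
  obtain ⟨k, hk⟩ := he (x, y)
  have := (hstep (S k).1 ((S k).2.toHom (e k).1) ((S k).2.toHom (e k).2)).map (ι (k + 1))
  rw [h₁, h₁, hι, hι, hk] at this
  exact this

/-- Each extension creates new pairs, so the previous lemma is iterated: two elements of the union
lie in a common stage and are solved in the next. -/
theorem exists_complete (D : ColoredGroup.{u} C K) :
    ∃ (E : ColoredGroup.{u} C K) (_ : Emb D E), ∀ x y, E.Solved x y := by
  choose next nextEmb hnext using fun E : ColoredGroup.{u} C K => E.exists_forall_solved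
  let S : ℕ → ColoredGroup.{u} C K := fun n => Nat.rec D (fun _ E => next E) n
  obtain ⟨E, ι, h₁, h₂⟩ := exists_union S (fun i => nextEmb (S i))
  refine ⟨E, ι 0, fun x y => ?_⟩
  obtain ⟨i, x, rfl⟩ := h₂ x
  obtain ⟨j, y, rfl⟩ := h₂ y
  have hlift {i k : ℕ} (h : i ≤ k) (x : S i) : ∃ x' : S k, (ι k).toHom x' = (ι i).toHom x := by
    induction k, h using Nat.le_induction with
    | base => exact ⟨x, rfl⟩
    | succ k _ ih =>
      obtain ⟨x', hx'⟩ := ih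
      exact ⟨(nextEmb _).toHom x', (h₁ _ _).trans hx'⟩
  obtain ⟨x', hx'⟩ := hlift (le_max_left i j) x
  obtain ⟨y', hy'⟩ := hlift (le_max_right i j) y
  rw [← hx', ← hy', ← h₁ _ x', ← h₁ _ y']
  exact (hnext (S (max i j)) x' y').map (ι (max i j + 1))

/-- The free group on the elements of `C` and of `K`, the elements of the kernel of the projection
to `C` being coloured by a letter of `K` with non-zero exponent sum. -/
theorem exists_coloredGroup (C : Type u) [Group C] [Countable C] (m : ℕ) [NeZero m] :
    ∃ D : ColoredGroup.{u} C (Fin m), Function.Surjective D.proj ∧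
      ∀ i, ∃ x : D, x ≠ 1 ∧ D.proj x = 1 ∧ D.color x = i := by
  classical
  let G := FreeGroup (C ⊕ Fin m)
  let e (i : Fin m) : G →* Multiplicative ℤ :=
    FreeGroup.lift (Sum.elim (fun _ => 1) (Pi.mulSingle i (Multiplicative.ofAdd 1)))
  -- The choice depends only on the set of letters with non-zero exponent sum, which conjugation and
  -- non-zero powers preserve.
  let color (g : G) : Fin m := if h : ∃ i, e i g ≠ 1 then h.choose else 0
  have hcolor (g g' : G) (h : ∀ i, e i g ≠ 1 ↔ e i g' ≠ 1) : color g = color g' := by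
    simp only [color, h]
  refine ⟨{ carrier := G
            countable := (Quot.mk_surjective (r := FreeGroup.Red.Step)).countable
            eq_one_of_pow_eq_one := fun g k hk h => (pow_eq_one_iff_left hk).1 h
            proj := FreeGroup.lift (Sum.elim id fun _ => 1)
            color := color
            color_conj := fun g p => hcolor _ _ fun i => by simp
            color_zpow := fun g k hk => hcolor _ _ fun i => ?_ }, fun c => ?_, fun i => ?_⟩
  · rw [map_zpow, not_iff_not]
    rw [← toAdd_eq_zero, toAdd_zpow, smul_eq_mul, mul_eq_zero, or_iff_right hk, toAdd_eq_zero]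
  · exact ⟨FreeGroup.of (Sum.inl c), FreeGroup.lift_apply_of⟩
  · have he (j : Fin m) : e j (FreeGroup.of (Sum.inr i)) ≠ 1 ↔ j = i := by
      by_cases h : j = i
      · subst h
        simp [e, G, FreeGroup.lift_apply_of]
      · simp [e, G, h, Ne.symm h, FreeGroup.lift_apply_of]
    refine ⟨FreeGroup.of (Sum.inr i), FreeGroup.of_ne_one _, FreeGroup.lift_apply_of, ?_⟩
    have h : ∃ j, e j (FreeGroup.of (Sum.inr i)) ≠ 1 := ⟨i, (he i).2 rfl⟩
    simp only [color, dif_pos h]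
    exact (he _).1 h.choose_spec

end ColoredGroup

/-! ### The kernel of the projection -/

theorem mainTheorem12 (C : Type u) [Group C] [Countable C] (n : ℕ) (hn : 2 ≤ n) :
    ∃ (H : Type u) (_ : Group H) (M : Subgroup H) (_ : M.Normal),
      Countable H ∧ IsTorsionFreeGroup H ∧
      HasNCC M n ∧
      IsBoundedlySimple 2 M ∧
      ConjPreservesClasses M ∧
      Nonempty (H ⧸ M ≃* C) := by
  obtain ⟨m, rfl⟩ : ∃ m, n = m + 1 := ⟨n - 1, by omega⟩
  have : NeZero m := ⟨by omega⟩
  obtain ⟨D, hD, hDc⟩ := ColoredGroup.exists_coloredGroup C m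
  obtain ⟨E, f, hE⟩ := D.exists_complete
  have hsurj : Function.Surjective E.proj := fun c => by
    obtain ⟨x, rfl⟩ := hD c
    exact ⟨f.toHom x, f.proj_apply x⟩
  have hconj {x y : E} (hx : x ∈ E.proj.ker) (hy : y ∈ E.proj.ker) (hx1 : x ≠ 1) (hy1 : y ≠ 1)
      (hc : E.color x = E.color y) : ∃ t ∈ E.proj.ker, t * x * t⁻¹ = y :=
    (hE x y hx1 hy1 hx hy).1 hc
  refine ⟨E, inferInstance, E.proj.ker, inferInstance, inferInstance, ?_, ?_, ?_, ?_,
    ⟨QuotientGroup.quotientKerEquivOfSurjective _ hsurj⟩⟩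
  · intro g hg hfin
    obtain ⟨k, hk, h⟩ := isOfFinOrder_iff_pow_eq_one.1 hfin
    exact hg (E.eq_one_of_pow_eq_one g k hk.ne' h)
  · classical
    -- The identity also carries a colour, so `none` separates its class from the `m` others.
    let c (x : E.proj.ker) : Option (Fin m) := if x = 1 then none else some (E.color x)
    have hc (x y : E.proj.ker) : IsConj x y ↔ c x = c y := by
      rw [isConj_iff]
      constructor
      · rintro ⟨t, rfl⟩
        have : E.color ((t * x * t⁻¹ : E.proj.ker) : E) = E.color x := E.color_conj x t
        simp only [c, conj_eq_one_iff, this]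
      · intro h
        by_cases hx : x = 1 <;> by_cases hy : y = 1
        · exact ⟨1, by simp [hx, hy]⟩
        · simp [c, hx, hy] at h
        · simp [c, hx, hy] at h
        · simp only [c, hx, hy, if_false, Option.some_inj] at h
          obtain ⟨t, ht, htx⟩ := hconj x.2 y.2 (by simpa using hx) (by simpa using hy) h
          exact ⟨⟨t, ht⟩, Subtype.ext htx⟩
    let F : ConjClasses E.proj.ker → Option (Fin m) := Quotient.lift c fun x y h => (hc x y).1 h
    have hF : Function.Bijective F := by
      constructor
      · rintro ⟨x⟩ ⟨y⟩ h
        exact Quotient.sound ((hc x y).2 h)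
      · rintro (_ | i)
        · exact ⟨ConjClasses.mk 1, if_pos rfl⟩
        · obtain ⟨x, hx, hpx, rfl⟩ := hDc i
          refine ⟨ConjClasses.mk ⟨f.toHom x, (f.proj_apply x).trans hpx⟩, ?_⟩
          refine (if_neg fun h => f.ne_one hx (congrArg Subtype.val h)).trans ?_
          exact congrArg some (f.color_apply x)
    rw [HasNCC, ENat.card_congr (Equiv.ofBijective F hF)]
    simp
  · intro x y hx hy
    obtain ⟨-, a, b, ha, hb, hab⟩ :=
      hE x y (by simpa using hx) (by simpa using hy) x.2 y.2
    exact ⟨[⟨a, ha⟩, ⟨b, hb⟩], le_rfl, Subtype.ext (by simpa using hab)⟩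
  · intro h a ha
    by_cases ha1 : a = 1
    · exact ⟨1, one_mem _, by simp [ha1]⟩
    · obtain ⟨t, ht, hta⟩ := hconj ha ((inferInstance : E.proj.ker.Normal).conj_mem a ha h) ha1
        (by simpa using ha1) (E.color_conj a h).symm
      exact ⟨t, ht, hta.symm⟩
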